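/- Let $G$ be a finite group. A real $G$-module is a finite-dimensional real vector space with a linear action of $G$, and $RO(G)$ is the Grothendieck group of real $G$-modules, i.e. of the commutative monoid of their isomorphism classes under direct sum. Let $\mathcal{P}(G)$ be the family of subgroups of $G$ consisting of the trivial subgroup and all $p$-subgroups of $G$ for all primes $p$ dividing $|G|$, and let $IO(G)$ be the intersection of the kernels of the restriction maps $RO(G) \to RO(P)$ taken for all $P \in \mathcal{P}(G)$. A real $G$-module $W$ is called $\mathcal{P}$-oriented if, for each $P \in \mathcal{P}(G)$, the fixed point space $W^P$ is oriented and the transformation $g : W^P \to W^P$ is orientation preserving for each $g \in N_G(P)$. Key Lemma. Let $U$ and $V$ be two real $G$-modules such that $U - V \in IO(G)$. Then the real $G$-module $U \oplus V$ is $\mathcal{P}$-oriented. -/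

import Mathlib

universe u v

/-- A real `G`-module: a finite-dimensional real vector space with a linear action of `G`. -/
structure RealGModule (G : Type u) [Group G] where
  carrier : Type v
  [addCommGroup : AddCommGroup carrier]
  [module : Module ℝ carrier]
  [finiteDimensional : FiniteDimensional ℝ carrier]
  rep : Representation ℝ G carrier

namespace RealGModule

attribute [instance] RealGModule.addCommGroup RealGModule.module RealGModule.finiteDimensional

/-- Isomorphism of real `G`-modules. -/
instance isoSetoid (G : Type u) [Group G] : Setoid (RealGModule.{u, v} G) where
  r M N := Nonempty (M.rep.Equiv N.rep)
  iseqv :=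
    ⟨fun M => ⟨.refl M.rep⟩, fun ⟨e⟩ => ⟨e.symm⟩, fun ⟨e⟩ ⟨f⟩ => ⟨e.trans f⟩⟩

variable {G : Type u} [Group G]

/-- The direct sum `M ⊕ N`. -/
noncomputable def directSum (M N : RealGModule.{u, v} G) : RealGModule.{u, v} G :=
  ⟨M.carrier × N.carrier, M.rep.prod N.rep⟩

/-- The zero module. -/
def zero (G : Type u) [Group G] : RealGModule.{u, v} G :=
  ⟨PUnit.{v + 1}, Representation.trivial ℝ G PUnit.{v + 1}⟩

/-- The real `H`-module obtained by restricting the action to a subgroup `H`. -/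
def restrict (H : Subgroup G) (M : RealGModule.{u, v} G) : RealGModule.{u, v} H :=
  ⟨M.carrier, M.rep.comp H.subtype⟩

end RealGModule

/-- Isomorphism classes of real `G`-modules. -/
def RealGModuleClass (G : Type u) [Group G] : Type (max u (v + 1)) :=
  Quotient (RealGModule.isoSetoid.{u, v} G)

namespace RealGModuleClass

variable {G : Type u} [Group G]

/-- Addition of isomorphism classes is induced by the direct sum. -/
noncomputable instance : Add (RealGModuleClass.{u, v} G) where
  add := Quotient.map₂ RealGModule.directSum (by
    rintro M M' ⟨e⟩ N N' ⟨f⟩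
    exact ⟨.mk (e.toLinearEquiv.prodCongr f.toLinearEquiv) (fun g => by
      refine LinearMap.ext fun x => Prod.ext ?_ ?_
      · exact congr($(e.isIntertwining' g) x.1)
      · exact congr($(f.isIntertwining' g) x.2))⟩)

noncomputable instance : Zero (RealGModuleClass.{u, v} G) where
  zero := Quotient.mk _ (RealGModule.zero G)

/-- Isomorphism classes of real `G`-modules form a commutative monoid under direct sum. -/
noncomputable instance : AddCommMonoid (RealGModuleClass.{u, v} G) where
  add_assoc := by
    rintro ⟨M⟩ ⟨N⟩ ⟨K⟩
    exact Quotient.sound ⟨.mk (LinearEquiv.prodAssoc ℝ _ _ _) (fun _ => rfl)⟩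
  zero_add := by
    rintro ⟨M⟩
    exact Quotient.sound ⟨.mk (LinearEquiv.uniqueProd (R := ℝ) (M₂ := PUnit.{v + 1}))
      (fun _ => rfl)⟩
  add_zero := by
    rintro ⟨M⟩
    exact Quotient.sound ⟨.mk (LinearEquiv.prodUnique (R := ℝ) (M₂ := PUnit.{v + 1}))
      (fun _ => rfl)⟩
  add_comm := by
    rintro ⟨M⟩ ⟨N⟩
    exact Quotient.sound ⟨.mk (LinearEquiv.prodComm ℝ _ _) (fun _ => rfl)⟩
  nsmul := nsmulRec

/-- Restriction of isomorphism classes to a subgroup. -/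
noncomputable def restrict (H : Subgroup G) :
    RealGModuleClass.{u, v} G →+ RealGModuleClass.{u, v} H where
  toFun := Quotient.map (RealGModule.restrict H) (by
    rintro M N ⟨e⟩
    exact ⟨.mk e.toLinearEquiv (fun h => e.isIntertwining' (h : G))⟩)
  map_zero' := rfl
  map_add' := by
    rintro ⟨M⟩ ⟨N⟩
    rfl

end RealGModuleClass

/-- The additive group of the real representation ring `RO(G)`: the Grothendieck group of the
monoid of isomorphism classes of real `G`-modules under direct sum. -/
abbrev RO (G : Type u) [Group G] : Type (max u (v + 1)) :=
  Algebra.GrothendieckAddGroup (RealGModuleClass.{u, v} G)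

namespace RO

variable {G : Type u} [Group G]

/-- The class in `RO(G)` of a finite-dimensional real representation of `G`. -/
noncomputable def ofRep {V : Type v} [AddCommGroup V] [Module ℝ V] [FiniteDimensional ℝ V]
    (ρ : Representation ℝ G V) : RO.{u, v} G :=
  Algebra.GrothendieckAddGroup.of (Quotient.mk (RealGModule.isoSetoid G) ⟨V, ρ⟩)

/-- The restriction homomorphism `RO(G) → RO(H)`. -/
noncomputable def restrict (H : Subgroup G) : RO.{u, v} G →+ RO.{u, v} H :=
  Algebra.GrothendieckAddGroup.lift
    (Algebra.GrothendieckAddGroup.of.comp (RealGModuleClass.restrict H))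

end RO

/-- The family `𝒫(G)`: the trivial subgroup of `G` and all `p`-subgroups of `G` for all
primes `p` dividing `|G|`. -/
def primePowerSubgroups (G : Type u) [Group G] : Set (Subgroup G) :=
  {P | P = ⊥ ∨ ∃ p : ℕ, p.Prime ∧ p ∣ Nat.card G ∧ IsPGroup p P}

/-- `IO(G)`: the intersection of the kernels of the restriction maps `RO(G) → RO(P)` taken for
all `P ∈ 𝒫(G)`. -/
noncomputable def IOGroup (G : Type u) [Group G] : AddSubgroup (RO.{u, v} G) :=
  ⨅ P ∈ primePowerSubgroups G, (RO.restrict P).ker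

section Orientation

variable {G : Type u} [Group G] {V : Type v} [AddCommGroup V] [Module ℝ V]

/-- The fixed point space `V^P`. -/
noncomputable def fixedSpace (ρ : Representation ℝ G V) (P : Subgroup G) : Submodule ℝ V :=
  Representation.invariants (ρ.comp P.subtype)

theorem map_mem_fixedSpace (ρ : Representation ℝ G V) (P : Subgroup G) {g : G}
    (hg : g ∈ Subgroup.normalizer (P : Set G)) {v : V} (hv : v ∈ fixedSpace ρ P) :
    ρ g v ∈ fixedSpace ρ P := by
  rintro ⟨x, hx⟩
  have hx' : g⁻¹ * x * g ∈ P := by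
    have h := (Subgroup.mem_normalizer_iff.mp (inv_mem hg) x).mp hx
    simpa using h
  have h2 : ρ (g⁻¹ * x * g) v = v := hv ⟨_, hx'⟩
  have h3 : ρ x (ρ g v) = ρ g (ρ (g⁻¹ * x * g) v) := by
    simp only [← Module.End.mul_apply, ← map_mul]
    congr 2
    group
  exact h3.trans (congrArg (ρ g) h2)

/-- For `g ∈ N_G(P)`, the transformation `g : V^P → V^P`. -/
noncomputable def fixedSpaceEquiv (ρ : Representation ℝ G V) (P : Subgroup G)
    (g : Subgroup.normalizer (P : Set G)) : fixedSpace ρ P ≃ₗ[ℝ] fixedSpace ρ P where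
  toFun v := ⟨ρ (g : G) v, map_mem_fixedSpace ρ P g.2 v.2⟩
  invFun v := ⟨ρ (g : G)⁻¹ v, map_mem_fixedSpace ρ P (inv_mem g.2) v.2⟩
  map_add' v w := Subtype.ext (map_add _ _ _)
  map_smul' c v := Subtype.ext (map_smul _ _ _)
  left_inv v := Subtype.ext (by simp)
  right_inv v := Subtype.ext (by simp)

/-- A real `G`-module `V` is `𝒫`-oriented if, for each `P ∈ 𝒫(G)`, the space `V^P` is oriented
and the transformation `g : V^P → V^P` preserves the orientation for each `g ∈ N_G(P)`. -/
def IsPOriented (ρ : Representation ℝ G V) : Prop :=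
  ∀ P ∈ primePowerSubgroups G,
    ∃ o : Orientation ℝ (fixedSpace ρ P) (Fin (Module.finrank ℝ (fixedSpace ρ P))),
      ∀ g : Subgroup.normalizer (P : Set G),
        Orientation.map (Fin (Module.finrank ℝ (fixedSpace ρ P))) (fixedSpaceEquiv ρ P g) o = o

end Orientation

/-! It suffices that each `g ∈ N_G(P)` has determinants of the same sign on `U^P` and `V^P`, since
their product is the determinant on `(U ⊕ V)^P`. Odd powers preserve signs, so `g` may be replaced
by its power of 2-power order.

If `P` is a 2-group, so is `⟨g⟩P`. Then `U` and `V` are stably isomorphic over `⟨g⟩P`, and the two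
determinants are equal.

If `P` is a `p`-group with `p` odd, a stable isomorphism is available over `P` and over `⟨g⟩`, but
not over both at once. The link is `det_mul_det_restrict_invariants_pos`: an automorphism commuting
with `P` has determinants of the same sign on the whole space and on the `P`-invariants. Indeed an
odd `p`-group without nonzero fixed vectors acts only on even-dimensional real spaces, so negative
eigenvalues on the complement contribute positively. Applied to the discrepancy between the actions
of `g` on the two sides (`det_mul_fixedSpaceDet_pos_of_equiv`), this reduces the signs on fixed
spaces to the signs of `g` on `U` and `V`, which agree because `⟨g⟩` is a 2-group. -/

/-! ### Real eigenvalues, parity of dimension and determinants -/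

section LinearAlgebra

open Module

variable {W : Type*} [AddCommGroup W] [Module ℝ W] [FiniteDimensional ℝ W]

theorem exists_neg_hasEigenvalue_of_det_neg {c : End ℝ W} (hc : LinearMap.det c < 0) :
    ∃ μ < 0, c.HasEigenvalue μ := by
  have : Nontrivial W := by
    by_contra h
    rw [not_nontrivial_iff_subsingleton] at h
    rw [LinearMap.det_eq_one_of_subsingleton] at hc
    linarith
  set q := (-c).charpoly
  -- The constant term of the characteristic polynomial of `-c` is `det c`; being monic, the
  -- polynomial then has a positive root.
  have hq0 : q.eval 0 < 0 := by
    have h1 := LinearMap.det_eq_sign_charpoly_coeff (-c)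
    rw [← neg_one_smul ℝ c, LinearMap.det_smul, neg_one_smul] at h1
    rw [← Polynomial.coeff_zero_eq_eval_zero]
    have h2 : LinearMap.det c = q.coeff 0 :=
      mul_left_cancel₀ (pow_ne_zero _ (by norm_num : (-1 : ℝ) ≠ 0)) h1
    exact h2 ▸ hc
  have hdeg : 0 < q.degree := by
    rw [← Polynomial.natDegree_pos_iff_degree_pos, LinearMap.charpoly_natDegree]
    exact finrank_pos
  have hlim := q.tendsto_atTop_of_leadingCoeff_nonneg hdeg
    (by rw [(LinearMap.charpoly_monic (-c)).leadingCoeff]; exact zero_le_one)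
  obtain ⟨b, hb, hb0⟩ := ((hlim.eventually_ge_atTop 0).and
    (Filter.eventually_ge_atTop 0)).exists
  obtain ⟨t, ht, hroot⟩ := intermediate_value_Icc hb0 q.continuous.continuousOn ⟨hq0.le, hb⟩
  have ht0 : 0 < t := lt_of_le_of_ne ht.1 (by rintro rfl; exact hq0.ne hroot)
  obtain ⟨v, hv⟩ :=
    ((End.hasEigenvalue_iff_isRoot_charpoly (-c) t).mpr hroot).exists_hasEigenvector
  refine ⟨-t, neg_lt_zero.mpr ht0, End.hasEigenvalue_of_hasEigenvector (x := v) ⟨?_, hv.2⟩⟩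
  have h := hv.apply_eq_smul
  rw [End.mem_eigenspace_iff, neg_smul, ← h]
  simp

theorem exists_hasEigenvalue_of_odd_finrank (hW : Odd (finrank ℝ W)) (T : End ℝ W) :
    ∃ μ, T.HasEigenvalue μ := by
  rcases lt_trichotomy (LinearMap.det T) 0 with h | h | h
  · obtain ⟨μ, -, hμ⟩ := exists_neg_hasEigenvalue_of_det_neg h
    exact ⟨μ, hμ⟩
  · refine ⟨0, ?_⟩
    rw [End.hasEigenvalue_iff, End.eigenspace_zero]
    exact (LinearMap.bot_lt_ker_of_det_eq_zero h).ne'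
  · have h' : LinearMap.det (-T) < 0 := by
      rw [← neg_one_smul ℝ T, LinearMap.det_smul, hW.neg_one_pow]
      linarith
    obtain ⟨μ, -, hμ⟩ := exists_neg_hasEigenvalue_of_det_neg h'
    obtain ⟨v, hv⟩ := hμ.exists_hasEigenvector
    refine ⟨-μ, End.hasEigenvalue_of_hasEigenvector (x := v) ⟨?_, hv.2⟩⟩
    rw [End.mem_eigenspace_iff, neg_smul, ← hv.apply_eq_smul]
    simp

/-- The range of `T - 1` has even dimension: otherwise `T` has a real eigenvalue there, necessarily
the only real `m`-th root of unity, 1, and a Jordan block for 1 contradicts finite order. -/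
theorem even_finrank_iff_of_pow_eq_one {T : End ℝ W} {m : ℕ} (hm : Odd m) (hT : T ^ m = 1) :
    Even (finrank ℝ W) ↔ Even (finrank ℝ (LinearMap.ker (T - 1))) := by
  have hR : Even (finrank ℝ (LinearMap.range (T - 1))) := by
    by_contra hodd
    have hstab : ∀ x ∈ LinearMap.range (T - 1), T x ∈ LinearMap.range (T - 1) := by
      rintro _ ⟨w, rfl⟩
      exact ⟨T w, by simp⟩
    obtain ⟨μ, hμ⟩ :=
      exists_hasEigenvalue_of_odd_finrank (Nat.not_even_iff_odd.mp hodd) (T.restrict hstab)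
    obtain ⟨⟨v, w, rfl⟩, hv⟩ := hμ.exists_hasEigenvector
    have hne : (T - 1) w ≠ 0 := fun h => hv.2 (Subtype.ext h)
    have hTv : T ((T - 1) w) = μ • (T - 1) w := congrArg Subtype.val hv.apply_eq_smul
    have hpow : ∀ k : ℕ, (T ^ k) ((T - 1) w) = μ ^ k • (T - 1) w := by
      intro k
      induction k with
      | zero => simp
      | succ k ih => rw [pow_succ', End.mul_apply, ih, map_smul, hTv, smul_smul, pow_succ]
    have hμm : μ ^ m = 1 := by
      have h := hpow m
      rw [hT, End.one_apply] at h
      exact (smul_left_injective ℝ hne (by simpa using h)).symm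
    have hμ1 : μ = 1 := hm.strictMono_pow.injective (by simpa using hμm)
    rw [hμ1, one_smul] at hTv
    have hw : ∀ k : ℕ, (T ^ k) w = w + (k : ℝ) • (T - 1) w := by
      intro k
      induction k with
      | zero => simp
      | succ k ih =>
        rw [pow_succ', End.mul_apply, ih, map_add, map_smul, hTv]
        simp only [LinearMap.sub_apply, End.one_apply, Nat.cast_add, Nat.cast_one]
        module
    have h := hw m
    rw [hT, End.one_apply, left_eq_add, smul_eq_zero] at h
    have hm0 : (m : ℝ) ≠ 0 := Nat.cast_ne_zero.mpr hm.pos.ne'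
    exact h.elim hm0 hne
  rw [← LinearMap.finrank_range_add_finrank_ker (T - 1), Nat.even_add]
  exact iff_true_left hR

/-- The determinant splits over `ker f` and `W / ker f`, and `f` identifies this quotient with its
range compatibly with `c`. Kernel and range need not be complementary. -/
theorem det_eq_det_restrict_ker_mul_det_restrict_range {c f : End ℝ W} (h : Commute f c)
    (hk : ∀ x ∈ LinearMap.ker f, c x ∈ LinearMap.ker f)
    (hr : ∀ x ∈ LinearMap.range f, c x ∈ LinearMap.range f) :
    LinearMap.det c = LinearMap.det (c.restrict hk) * LinearMap.det (c.restrict hr) := by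
  rw [c.det_eq_det_mul_det (LinearMap.ker f) hk]
  congr 1
  rw [← LinearMap.det_conj _ f.quotKerEquivRange]
  congr 1
  ext ⟨_, w, rfl⟩
  have : f.quotKerEquivRange.symm ⟨f w, w, rfl⟩ = (LinearMap.ker f).mkQ w :=
    f.quotKerEquivRange_symm_apply_image w _
  simp [this]
  exact congr($(h.eq) w)

end LinearAlgebra

/-! ### Endomorphisms commuting with an odd p-group -/

section PGroup

open Module

variable {p : ℕ}

theorem mem_invariants_iff_of_isCoatom {K : Type u} [Group K] {W : Type v} [AddCommGroup W]
    [Module ℝ W] (ρ : Representation ℝ K W) {N : Subgroup K} (hN : IsCoatom N) {z : K}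
    (hz : z ∉ N) {w : W} (hw : w ∈ fixedSpace ρ N) :
    w ∈ ρ.invariants ↔ ρ z w = w := by
  refine ⟨fun h => h z, fun h => ?_⟩
  let S : Subgroup K :=
    { carrier := {k | ρ k w = w}
      one_mem' := by simp
      mul_mem' := fun {a b} ha hb => by
        change ρ (a * b) w = w
        rw [map_mul, End.mul_apply, show ρ b w = w from hb, show ρ a w = w from ha]
      inv_mem' := fun {a} ha => by
        change ρ a⁻¹ w = w
        nth_rw 1 [← show ρ a w = w from ha]
        simp }
  have hNS : N < S := lt_of_le_of_ne (fun n hn => hw ⟨n, hn⟩) fun e => hz (e ▸ h)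
  intro k
  have : k ∈ S := hN.2 S hNS ▸ Subgroup.mem_top k
  exact this

/-- The action of the normalizer `N_G(P)` on the fixed point space `V^P`. -/
noncomputable def fixedSpaceRep {G : Type u} [Group G] {V : Type v} [AddCommGroup V] [Module ℝ V]
    (ρ : Representation ℝ G V) (P : Subgroup G) :
    Representation ℝ (Subgroup.normalizer (P : Set G)) (fixedSpace ρ P) where
  toFun g := (fixedSpaceEquiv ρ P g).toLinearMap
  map_one' := by
    ext v
    exact congr($(map_one ρ) v)
  map_mul' g h := by
    ext v
    exact congr($(map_mul ρ (g : G) h) v)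

/-- Induction through a maximal subgroup `N`, normal because `K` is nilpotent: an element `z`
outside `N` acts on the `N`-invariants with odd order, and its fixed vectors there are the
`K`-invariants. -/
theorem even_finrank_iff_even_finrank_invariants {K : Type u} [Group K] [Finite K]
    (hp : Odd p) [Fact p.Prime] (hK : IsPGroup p K) {W : Type v} [AddCommGroup W] [Module ℝ W]
    [FiniteDimensional ℝ W] (ρ : Representation ℝ K W) :
    Even (finrank ℝ W) ↔ Even (finrank ℝ ρ.invariants) := by
  induction hn : Nat.card K using Nat.strong_induction_on generalizing K with
  | h n ih =>
  rcases eq_top_or_exists_le_coatom (⊥ : Subgroup K) with htop | ⟨N, hN, -⟩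
  · have : ρ.invariants = ⊤ := by
      refine eq_top_iff.mpr fun w _ k => ?_
      have : k = 1 := Subgroup.mem_bot.mp (htop ▸ Subgroup.mem_top k)
      simp [this]
    rw [this, finrank_top]
  · have hNn : N.Normal :=
      have := hK.isNilpotent
      Subgroup.NormalizerCondition.normal_of_coatom N Group.normalizerCondition_of_isNilpotent hN
    obtain ⟨z, hz⟩ : ∃ z, z ∉ N := by
      by_contra! h
      exact hN.1 (eq_top_iff.mpr fun x _ => h x)
    have hzN : z ∈ Subgroup.normalizer (N : Set K) := by
      rw [Subgroup.normalizer_eq_top]; trivial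
    have hcard : Nat.card N < n := by
      rw [← hn, ← Subgroup.card_top (G := K)]
      exact Set.ncard_lt_ncard (SetLike.coe_ssubset_coe.mpr hN.1.lt_top)
    rw [ih _ hcard (hK.to_subgroup N) (ρ.comp N.subtype) rfl]
    obtain ⟨m, hm⟩ := hK z
    set T : End ℝ (fixedSpace ρ N) := fixedSpaceRep ρ N ⟨z, hzN⟩ with hTdef
    have hT : T ^ (p ^ m) = 1 := by
      rw [hTdef, ← map_pow, ← map_one (fixedSpaceRep ρ N)]
      congr 1
      exact Subtype.ext (hm)
    refine (even_finrank_iff_of_pow_eq_one (hp.pow) hT).trans ?_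
    rw [← Submodule.finrank_map_subtype_eq]
    suffices (LinearMap.ker (T - 1)).map (fixedSpace ρ N).subtype = ρ.invariants by rw [this]
    ext w
    constructor
    · rintro ⟨w, hw, rfl⟩
      refine (mem_invariants_iff_of_isCoatom ρ hN hz w.2).mpr ?_
      rw [SetLike.mem_coe, LinearMap.mem_ker, LinearMap.sub_apply, sub_eq_zero] at hw
      exact congrArg Subtype.val hw
    · intro hw
      have hw' : w ∈ fixedSpace ρ N := fun x => hw x
      refine ⟨⟨w, hw'⟩, ?_, rfl⟩
      rw [SetLike.mem_coe, LinearMap.mem_ker, LinearMap.sub_apply, sub_eq_zero]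
      exact Subtype.ext (hw z)

/-- A negative determinant would give a negative eigenvalue `μ`. Its eigenspace is `K`-stable
without fixed vectors, hence of even dimension, and contributes a positive power of `μ`; induction
handles the range of `c - μ`. -/
theorem det_pos_of_invariants_eq_bot {K : Type u} [Group K] [Finite K]
    (hp : Odd p) [Fact p.Prime] (hK : IsPGroup p K) {W : Type v} [AddCommGroup W] [Module ℝ W]
    [FiniteDimensional ℝ W] (ρ : Representation ℝ K W) (hρ : ρ.invariants = ⊥)
    {c : End ℝ W} (hc : ∀ k, Commute (ρ k) c) (hc0 : LinearMap.det c ≠ 0) :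
    0 < LinearMap.det c := by
  induction hn : finrank ℝ W using Nat.strong_induction_on generalizing W with
  | h n ih =>
  by_contra hneg
  obtain ⟨μ, hμ, hev⟩ :=
    exists_neg_hasEigenvalue_of_det_neg (lt_of_le_of_ne (not_lt.mp hneg) hc0)
  set f : End ℝ W := c - algebraMap ℝ (End ℝ W) μ with hf
  have hρf : ∀ k, Commute (ρ k) f := fun k =>
    (hc k).sub_right (Algebra.commutes μ (ρ k)).symm
  have hfc : Commute f c := (Commute.refl c).sub_left (Algebra.commutes μ c)
  have ker_stable : ∀ d : End ℝ W, Commute d f → ∀ x ∈ LinearMap.ker f, d x ∈ LinearMap.ker f := by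
    intro d hd x hx
    rw [LinearMap.mem_ker] at hx ⊢
    rw [← End.mul_apply, ← hd.eq, End.mul_apply, hx, map_zero]
  have range_stable :
      ∀ d : End ℝ W, Commute d f → ∀ x ∈ LinearMap.range f, d x ∈ LinearMap.range f := by
    rintro d hd _ ⟨x, rfl⟩
    exact ⟨d x, congr($(hd.eq.symm) x)⟩
  have hsub : ∀ τ : Subrepresentation ρ, τ.toRepresentation.invariants = ⊥ := by
    intro τ
    refine (Submodule.eq_bot_iff _).mpr fun x hx => Subtype.ext ?_
    have : (x : W) ∈ ρ.invariants := fun k => congrArg Subtype.val (hx k)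
    rwa [hρ, Submodule.mem_bot] at this
  let τk : Subrepresentation ρ := ⟨LinearMap.ker f, fun k => ker_stable _ (hρf k)⟩
  let τr : Subrepresentation ρ := ⟨LinearMap.range f, fun k => range_stable _ (hρf k)⟩
  have hdet := det_eq_det_restrict_ker_mul_det_restrict_range hfc
    (ker_stable c hfc.symm) (range_stable c hfc.symm)
  have hkeven : Even (finrank ℝ (LinearMap.ker f)) := by
    refine (even_finrank_iff_even_finrank_invariants hp hK τk.toRepresentation).mpr ?_
    rw [hsub τk, finrank_bot]
    exact Even.zero
  have hk : LinearMap.det (c.restrict (ker_stable c hfc.symm)) =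
      μ ^ finrank ℝ (LinearMap.ker f) := by
    have : c.restrict (ker_stable c hfc.symm) = μ • LinearMap.id := by
      ext ⟨x, hx⟩
      rw [hf, LinearMap.mem_ker, LinearMap.sub_apply, sub_eq_zero] at hx
      exact hx
    rw [this, LinearMap.det_smul, LinearMap.det_id, mul_one]
  have hkpos : 0 < LinearMap.det (c.restrict (ker_stable c hfc.symm)) :=
    hk ▸ hkeven.pow_pos hμ.ne
  have hker : 0 < finrank ℝ (LinearMap.ker f) := by
    rw [Module.finrank_pos_iff, Submodule.nontrivial_iff_ne_bot]
    rwa [End.hasEigenvalue_iff, End.eigenspace_def] at hev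
  have hlt : finrank ℝ (LinearMap.range f) < n := by
    have := LinearMap.finrank_range_add_finrank_ker f
    omega
  have hrpos : 0 < LinearMap.det (c.restrict (range_stable c hfc.symm)) := by
    refine ih _ hlt τr.toRepresentation (hsub τr) (fun k => ?_) (fun h => ?_) rfl
    · ext x
      exact congr($((hc k).eq) (x : W))
    · rw [hdet, h, mul_zero] at hc0
      exact hc0 rfl
  exact hneg (hdet ▸ mul_pos hkpos hrpos)

theorem invariants_stable {K : Type u} [Group K] {W : Type v} [AddCommGroup W] [Module ℝ W]
    (ρ : Representation ℝ K W) {c : End ℝ W} (hc : ∀ k, Commute (ρ k) c) :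
    ∀ x ∈ ρ.invariants, c x ∈ ρ.invariants := fun x hx k => by
  rw [← End.mul_apply, (hc k).eq, End.mul_apply, hx k]

theorem det_mul_det_restrict_invariants_pos {K : Type u} [Group K] [Finite K]
    (hp : Odd p) [Fact p.Prime] (hK : IsPGroup p K) {W : Type v} [AddCommGroup W] [Module ℝ W]
    [FiniteDimensional ℝ W] (ρ : Representation ℝ K W)
    {c : End ℝ W} (hc : ∀ k, Commute (ρ k) c) (hc0 : LinearMap.det c ≠ 0) :
    0 < LinearMap.det c * LinearMap.det (c.restrict (invariants_stable ρ hc)) := by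
  have : Fintype K := Fintype.ofFinite K
  have : Invertible (Fintype.card K : ℝ) :=
    invertibleOfNonzero (Nat.cast_ne_zero.mpr Fintype.card_ne_zero)
  -- The projection along the invariants onto the complementary subrepresentation, which has no
  -- nonzero fixed vectors.
  set f : End ℝ W := 1 - ρ.averageMap with hf
  have hcomm : ∀ d : End ℝ W, (∀ k, Commute (ρ k) d) → Commute f d := by
    intro d hd
    refine (Commute.one_left d).sub_left ?_
    rw [Representation.averageMap, GroupAlgebra.average, map_smul, map_sum]
    refine Commute.smul_left (Commute.sum_left _ _ _ fun k _ => ?_) _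
    simpa using hd k
  have hker : LinearMap.ker f = ρ.invariants := by
    ext x
    rw [hf, LinearMap.mem_ker, LinearMap.sub_apply, sub_eq_zero, End.one_apply]
    exact ⟨fun h => h ▸ ρ.averageMap_invariant x, fun h => (ρ.averageMap_id x h).symm⟩
  have hρf : ∀ k, Commute f (ρ k) := fun k => by
    refine (Commute.one_left _).sub_left ?_
    have h1 : ρ.averageMap * ρ k = ρ.averageMap := by
      rw [Representation.averageMap, ← Representation.asAlgebraHom_single_one, ← map_mul,
        GroupAlgebra.mul_average_right]
    have h2 : ρ k * ρ.averageMap = ρ.averageMap := by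
      ext x
      exact ρ.averageMap_invariant x k
    rw [Commute, SemiconjBy, h1, h2]
  have hfc := hcomm c hc
  have hr : ∀ d : End ℝ W, Commute f d → ∀ x ∈ LinearMap.range f, d x ∈ LinearMap.range f := by
    rintro d hd _ ⟨x, rfl⟩
    exact ⟨d x, congr($(hd.eq) x)⟩
  have hk : ∀ x ∈ LinearMap.ker f, c x ∈ LinearMap.ker f := by
    rw [hker]
    exact invariants_stable ρ hc
  have hdet := det_eq_det_restrict_ker_mul_det_restrict_range hfc hk (hr c hfc)
  have hdk : LinearMap.det (c.restrict hk) =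
      LinearMap.det (c.restrict (invariants_stable ρ hc)) := by
    -- The subspace is generalised to a variable so that the equality can be substituted inside the
    -- dependent restriction.
    have aux : ∀ (q : Submodule ℝ W) (hq : ∀ x ∈ q, c x ∈ q), q = ρ.invariants →
        LinearMap.det (c.restrict hq) =
          LinearMap.det (c.restrict (invariants_stable ρ hc)) := by
      rintro q hq rfl
      rfl
    exact aux _ hk hker
  let τ : Subrepresentation ρ := ⟨LinearMap.range f, fun k => hr _ (hρf k)⟩
  have hτ : τ.toRepresentation.invariants = ⊥ := by
    refine (Submodule.eq_bot_iff _).mpr ?_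
    rintro ⟨_, w, rfl⟩ hx
    have h1 : f w ∈ LinearMap.ker f := by
      rw [hker]
      exact fun k => congrArg Subtype.val (hx k)
    have h2 : f (f w) = f w := by
      have h3 : ρ.averageMap (ρ.averageMap w) = ρ.averageMap w :=
        ρ.averageMap_id _ (ρ.averageMap_invariant w)
      simp only [hf, LinearMap.sub_apply, End.one_apply, map_sub, h3, sub_self, sub_zero]
    exact Subtype.ext (h2.symm.trans h1)
  rw [hdet] at hc0
  have hpos : 0 < LinearMap.det (c.restrict (hr c hfc)) := by
    refine det_pos_of_invariants_eq_bot hp hK τ.toRepresentation hτ (fun k => ?_)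
      (right_ne_zero_of_mul hc0)
    ext x
    exact congr($((hc k).eq) (x : W))
  rw [hdet, ← hdk, mul_right_comm]
  exact mul_pos (mul_self_pos.mpr (left_ne_zero_of_mul hc0)) hpos

end PGroup

/-! ### Determinants on fixed spaces -/

section FixedSpaceDet

open Module

variable {G : Type u} [Group G]

/-- The determinant of `g : V^P → V^P`, for `g ∈ N_G(P)`. -/
noncomputable def fixedSpaceDet {V : Type*} [AddCommGroup V] [Module ℝ V]
    (ρ : Representation ℝ G V) (P : Subgroup G) (g : Subgroup.normalizer (P : Set G)) : ℝ :=
  LinearMap.det (fixedSpaceRep ρ P g)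

variable {A : Type*} [AddCommGroup A] [Module ℝ A] {B : Type*} [AddCommGroup B] [Module ℝ B]
  (α : Representation ℝ G A) (β : Representation ℝ G B) (P : Subgroup G)
  (g : Subgroup.normalizer (P : Set G))

theorem fixedSpaceDet_pow (m : ℕ) : fixedSpaceDet α P (g ^ m) = fixedSpaceDet α P g ^ m := by
  simp only [fixedSpaceDet, map_pow]

theorem fixedSpaceDet_mul_fixedSpaceDet_inv :
    fixedSpaceDet α P g * fixedSpaceDet α P g⁻¹ = 1 := by
  rw [fixedSpaceDet, fixedSpaceDet, ← map_mul, ← map_mul, mul_inv_cancel, map_one, map_one]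

theorem fixedSpaceDet_ne_zero : fixedSpaceDet α P g ≠ 0 :=
  left_ne_zero_of_mul_eq_one (fixedSpaceDet_mul_fixedSpaceDet_inv α P g)

theorem det_rep_mul_det_rep_inv (x : G) :
    LinearMap.det (α x) * LinearMap.det (α x⁻¹) = 1 := by
  rw [← map_mul, ← map_mul, mul_inv_cancel, map_one, map_one]

theorem det_rep_ne_zero (x : G) : LinearMap.det (α x) ≠ 0 :=
  left_ne_zero_of_mul_eq_one (det_rep_mul_det_rep_inv α x)

theorem det_prod_rep [FiniteDimensional ℝ A] [FiniteDimensional ℝ B] (x : G) :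
    LinearMap.det (α.prod β x) = LinearMap.det (α x) * LinearMap.det (β x) :=
  LinearMap.det_prodMap _ _

/-- `(A ⊕ B)^P = A^P ⊕ B^P`. -/
noncomputable def fixedSpaceProdEquiv :
    fixedSpace (α.prod β) P ≃ₗ[ℝ] fixedSpace α P × fixedSpace β P where
  toFun x := (⟨x.1.1, fun k => congrArg Prod.fst (x.2 k)⟩,
    ⟨x.1.2, fun k => congrArg Prod.snd (x.2 k)⟩)
  invFun x := ⟨(x.1, x.2), fun k => Prod.ext (x.1.2 k) (x.2.2 k)⟩
  map_add' _ _ := rfl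
  map_smul' _ _ := rfl
  left_inv _ := rfl
  right_inv _ := rfl

theorem fixedSpaceDet_prod [FiniteDimensional ℝ A] [FiniteDimensional ℝ B] :
    fixedSpaceDet (α.prod β) P g = fixedSpaceDet α P g * fixedSpaceDet β P g := by
  rw [fixedSpaceDet, fixedSpaceDet, fixedSpaceDet, ← LinearMap.det_prodMap,
    ← LinearMap.det_conj _ (fixedSpaceProdEquiv α β P)]
  rfl

variable {α β P}

/-- The isomorphism `A^P ≃ B^P` induced by a `P`-equivariant isomorphism `A ≃ B`. -/
noncomputable def fixedSpaceCongr (φ : A ≃ₗ[ℝ] B) (hφ : ∀ x ∈ P, ∀ a, φ (α x a) = β x (φ a)) :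
    fixedSpace α P ≃ₗ[ℝ] fixedSpace β P where
  toFun a := ⟨φ a, fun k => (hφ k k.2 a).symm.trans (congrArg φ (a.2 k))⟩
  invFun b := ⟨φ.symm b, fun k => φ.injective <| (hφ k k.2 _).trans <| by
    rw [φ.apply_symm_apply]
    exact b.2 k⟩
  map_add' _ _ := Subtype.ext (map_add _ _ _)
  map_smul' _ _ := Subtype.ext (map_smul _ _ _)
  left_inv _ := Subtype.ext (φ.symm_apply_apply _)
  right_inv _ := Subtype.ext (φ.apply_symm_apply _)

theorem fixedSpaceDet_congr (φ : A ≃ₗ[ℝ] B) (hφ : ∀ x ∈ P, ∀ a, φ (α x a) = β x (φ a))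
    (hg : ∀ a, φ (α g a) = β g (φ a)) : fixedSpaceDet α P g = fixedSpaceDet β P g := by
  rw [fixedSpaceDet, fixedSpaceDet, ← LinearMap.det_conj _ (fixedSpaceCongr φ hφ)]
  congr 1
  ext b
  change φ (α g (φ.symm b)) = β g b
  rw [hg, φ.apply_symm_apply]

theorem det_rep_congr (φ : A ≃ₗ[ℝ] B) {x : G} (hx : ∀ a, φ (α x a) = β x (φ a)) :
    LinearMap.det (α x) = LinearMap.det (β x) := by
  rw [← LinearMap.det_conj _ φ]
  congr 1
  ext b
  change φ (α x (φ.symm b)) = β x b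
  rw [hx, φ.apply_symm_apply]

/-- `φ` need not respect `g`. The discrepancy `c = φ⁻¹ β(g)⁻¹ φ α(g)` nevertheless commutes with
`P`, since the conjugations by `g` and `g⁻¹` cancel, so its determinants on `A` and `A^P` have the
same sign. -/
theorem det_mul_fixedSpaceDet_pos_of_equiv [Finite G] {p : ℕ} [Fact p.Prime] (hp : Odd p)
    (hP : IsPGroup p P) [FiniteDimensional ℝ A] (φ : A ≃ₗ[ℝ] B)
    (hφ : ∀ x ∈ P, ∀ a, φ (α x a) = β x (φ a)) :
    0 < (LinearMap.det (α g) * fixedSpaceDet α P g) *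
      (LinearMap.det (β g) * fixedSpaceDet β P g) := by
  set c : End ℝ A := (φ.symm.toLinearMap ∘ₗ β (g : G)⁻¹ ∘ₗ φ.toLinearMap) * α g with hc
  have hdet : LinearMap.det c = LinearMap.det (β (g : G)⁻¹) * LinearMap.det (α g) := by
    rw [hc, map_mul, ← LinearMap.det_conj (β (g : G)⁻¹) φ.symm, φ.symm_symm]
  have hsymm : ∀ x ∈ P, ∀ b, φ.symm (β x b) = α x (φ.symm b) := fun x hx b => by
    rw [φ.symm_apply_eq, hφ x hx, φ.apply_symm_apply]
  have hcomm : ∀ k : P, Commute (α.comp P.subtype k) c := by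
    rintro ⟨x, hx⟩
    have hx' : (g : G) * x * (g : G)⁻¹ ∈ P := (Subgroup.mem_normalizer_iff.mp g.2 x).mp hx
    ext a
    change α x (φ.symm (β (g : G)⁻¹ (φ (α g a)))) = φ.symm (β (g : G)⁻¹ (φ (α g (α x a))))
    have h1 : α g (α x a) = α ((g : G) * x * (g : G)⁻¹) (α g a) := by
      simp only [← End.mul_apply, ← map_mul]
      congr 2
      group
    rw [h1, hφ _ hx', ← hsymm x hx]
    simp only [← End.mul_apply, ← map_mul]
    congr 3
    group
  have hres : LinearMap.det (c.restrict (invariants_stable _ hcomm)) =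
      fixedSpaceDet β P g⁻¹ * fixedSpaceDet α P g := by
    rw [fixedSpaceDet, ← LinearMap.det_conj (fixedSpaceRep β P g⁻¹) (fixedSpaceCongr φ hφ).symm,
      fixedSpaceDet, ← map_mul]
    rfl
  have hpos := det_mul_det_restrict_invariants_pos hp hP (α.comp P.subtype) hcomm
    (by
      rw [hdet]
      exact mul_ne_zero (det_rep_ne_zero β _) (det_rep_ne_zero α _))
  rw [hres, hdet] at hpos
  have h1 := det_rep_mul_det_rep_inv β g
  have h2 := fixedSpaceDet_mul_fixedSpaceDet_inv β P g
  -- Multiplying by this square turns the determinants of `g⁻¹` on the `β` side into those of `g`.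
  have h3 : 0 < (LinearMap.det (β g) * fixedSpaceDet β P g) ^ 2 := by
    have := mul_ne_zero (det_rep_ne_zero β (g : G)) (fixedSpaceDet_ne_zero β P g)
    positivity
  refine (mul_pos hpos h3).trans_eq ?_
  linear_combination (LinearMap.det (α (g : G)) * fixedSpaceDet α P g) *
    (LinearMap.det (β g) * fixedSpaceDet β P g) *
      (fixedSpaceDet β P g * fixedSpaceDet β P g⁻¹ * h1 + h2)

end FixedSpaceDet

/-! ### Extending a stabilising summand from a subgroup to the group -/

section Extension

open Module

variable {G : Type u} [Group G] {H : Subgroup G}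
  {W : Type*} [AddCommGroup W] [Module ℝ W]

/-- The action of `G` by right translation on the functions `G → W`. -/
noncomputable def translationRep (G : Type u) [Group G] (W : Type*) [AddCommGroup W]
    [Module ℝ W] : Representation ℝ G (G → W) where
  toFun g := LinearMap.funLeft ℝ W (· * g)
  map_one' := by
    ext f x
    simp [LinearMap.funLeft]
  map_mul' g h := by
    ext f x
    simp [LinearMap.funLeft, mul_assoc]

open Classical in
/-- The `H`-equivariant embedding of `W` into `G → W`, extending an orbit map by zero. -/
noncomputable def extendOrbit (θ : Representation ℝ H W) : W →ₗ[ℝ] (G → W) :=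
  LinearMap.pi fun x => if hx : x ∈ H then θ ⟨x, hx⟩ else 0

open Classical in
theorem extendOrbit_equivariant (θ : Representation ℝ H W) (h : H) (w : W) :
    extendOrbit θ (θ h w) = translationRep G W h (extendOrbit θ w) := by
  funext x
  change (if hx : x ∈ H then θ ⟨x, hx⟩ else 0 : W →ₗ[ℝ] W) (θ h w) =
    (if hx : x * h ∈ H then θ ⟨x * h, hx⟩ else 0 : W →ₗ[ℝ] W) w
  by_cases hx : x ∈ H
  · rw [dif_pos hx, dif_pos (mul_mem hx h.2), ← End.mul_apply, ← map_mul]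
    rfl
  · rw [dif_neg hx, dif_neg (fun hxh => hx ((Subgroup.mul_mem_cancel_right H h.2).mp hxh))]
    rfl

/-- An `H`-equivariant retraction of `extendOrbit`, obtained by averaging. -/
noncomputable def averageOrbit (θ : Representation ℝ H W) : (G → W) →ₗ[ℝ] W :=
  (Nat.card H : ℝ)⁻¹ • ∑ᶠ h : H, θ h⁻¹ ∘ₗ LinearMap.proj (h : G)

theorem averageOrbit_apply [Fintype H] (θ : Representation ℝ H W) (f : G → W) :
    averageOrbit θ f = (Nat.card H : ℝ)⁻¹ • ∑ h : H, θ h⁻¹ (f h) := by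
  rw [averageOrbit, finsum_eq_sum_of_fintype]
  simp

theorem averageOrbit_equivariant [Finite G] (θ : Representation ℝ H W) (h : H) (f : G → W) :
    averageOrbit θ (translationRep G W h f) = θ h (averageOrbit θ f) := by
  have : Fintype H := Fintype.ofFinite H
  rw [averageOrbit_apply, averageOrbit_apply, map_smul, map_sum]
  congr 1
  refine Fintype.sum_equiv (Equiv.mulRight h) _ _ fun k => ?_
  rw [← End.mul_apply, ← map_mul]
  change θ k⁻¹ (f (k * h)) = θ (h * (k * h)⁻¹) (f (k * h))
  congr 2
  group

theorem averageOrbit_extendOrbit [Finite G] (θ : Representation ℝ H W) (w : W) :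
    averageOrbit θ (extendOrbit θ w) = w := by
  have : Fintype H := Fintype.ofFinite H
  rw [averageOrbit_apply]
  have h1 : ∀ h : H, θ h⁻¹ (extendOrbit θ w h) = w := fun h => by
    have : extendOrbit θ w h = θ h w := by
      simp [extendOrbit]
    rw [this, ← End.mul_apply, ← map_mul, inv_mul_cancel, map_one, End.one_apply]
  simp only [h1, Finset.sum_const, Finset.card_univ, Nat.card_eq_fintype_card]
  rw [← Nat.cast_smul_eq_nsmul ℝ, smul_smul, inv_mul_cancel₀, one_smul]
  exact Nat.cast_ne_zero.mpr Fintype.card_ne_zero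

variable {A : Type*} [AddCommGroup A] [Module ℝ A] {B : Type*} [AddCommGroup B] [Module ℝ B]

/-- Extension of a map `W ⊕ A → W ⊕ B` along the splitting of `G → W`. -/
noncomputable def extendMap (θ : Representation ℝ H W) (φ : W × A →ₗ[ℝ] W × B) :
    (G → W) × A →ₗ[ℝ] (G → W) × B where
  toFun x := (x.1 - extendOrbit θ (averageOrbit θ x.1) +
    extendOrbit θ (φ (averageOrbit θ x.1, x.2)).1, (φ (averageOrbit θ x.1, x.2)).2)
  map_add' x y := by
    have : (averageOrbit θ (x + y).1, (x + y).2) =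
      (averageOrbit θ x.1, x.2) + (averageOrbit θ y.1, y.2) := by simp
    rw [this, map_add]
    refine Prod.ext ?_ rfl
    simp only [Prod.fst_add, map_add]
    abel
  map_smul' r x := by
    have : (averageOrbit θ (r • x).1, (r • x).2) = r • (averageOrbit θ x.1, x.2) := by simp
    rw [this, map_smul]
    refine Prod.ext ?_ rfl
    simp only [Prod.smul_fst, map_smul, smul_add, smul_sub, RingHom.id_apply]

theorem extendMap_extendMap [Finite G] (θ : Representation ℝ H W) (φ : W × A →ₗ[ℝ] W × B)
    (ψ : W × B →ₗ[ℝ] W × A) (h : ∀ x, ψ (φ x) = x) (x : (G → W) × A) :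
    extendMap θ ψ (extendMap θ φ x) = x := by
  set y := φ (averageOrbit θ x.1, x.2) with hy
  have h1 : averageOrbit θ (extendMap θ φ x).1 = y.1 := by
    change averageOrbit θ (x.1 - extendOrbit θ (averageOrbit θ x.1) + extendOrbit θ y.1) = y.1
    rw [map_add, map_sub, averageOrbit_extendOrbit, averageOrbit_extendOrbit, sub_self, zero_add]
  have h2 : ψ (averageOrbit θ (extendMap θ φ x).1, (extendMap θ φ x).2) =
      (averageOrbit θ x.1, x.2) := by
    rw [h1]
    exact h _
  refine Prod.ext ?_ (show (ψ _).2 = x.2 from congrArg Prod.snd h2)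
  change (extendMap θ φ x).1 - extendOrbit θ (averageOrbit θ (extendMap θ φ x).1) +
    extendOrbit θ (ψ (averageOrbit θ (extendMap θ φ x).1, (extendMap θ φ x).2)).1 = x.1
  rw [h2, h1]
  change x.1 - extendOrbit θ (averageOrbit θ x.1) + extendOrbit θ y.1 - extendOrbit θ y.1 +
    extendOrbit θ (averageOrbit θ x.1) = x.1
  abel

theorem extendMap_equivariant [Finite G] (θ : Representation ℝ H W) (α : Representation ℝ G A)
    (β : Representation ℝ G B) (φ : W × A →ₗ[ℝ] W × B) (h : H)
    (hφ : ∀ x, φ (θ h x.1, α h x.2) = (θ h (φ x).1, β h (φ x).2)) (x : (G → W) × A) :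
    extendMap θ φ ((translationRep G W).prod α h x) =
      (translationRep G W).prod β h (extendMap θ φ x) := by
  have h1 : φ (averageOrbit θ (translationRep G W h x.1), α h x.2) =
      (θ h (φ (averageOrbit θ x.1, x.2)).1, β h (φ (averageOrbit θ x.1, x.2)).2) := by
    rw [averageOrbit_equivariant]
    exact hφ (averageOrbit θ x.1, x.2)
  refine Prod.ext ?_ (show (φ _).2 = β h (φ _).2 from congrArg Prod.snd h1)
  change translationRep G W h x.1 -
      extendOrbit θ (averageOrbit θ (translationRep G W h x.1)) +
      extendOrbit θ (φ (averageOrbit θ (translationRep G W h x.1), α h x.2)).1 =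
    translationRep G W h (x.1 - extendOrbit θ (averageOrbit θ x.1) +
      extendOrbit θ (φ (averageOrbit θ x.1, x.2)).1)
  rw [h1, averageOrbit_equivariant, extendOrbit_equivariant, extendOrbit_equivariant, map_add,
    map_sub]

/-- A stable isomorphism over `H` may be stabilised by a representation of the whole group. -/
theorem exists_equiv_prod_translationRep [Finite G] (θ : Representation ℝ H W) (α : Representation ℝ G A)
    (β : Representation ℝ G B) (φ : (W × A) ≃ₗ[ℝ] (W × B))
    (hφ : ∀ (h : H) x, φ (θ h x.1, α h x.2) = (θ h (φ x).1, β h (φ x).2)) :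
    ∃ Φ : ((G → W) × A) ≃ₗ[ℝ] ((G → W) × B), ∀ h ∈ H, ∀ x,
      Φ ((translationRep G W).prod α h x) = (translationRep G W).prod β h (Φ x) :=
  ⟨{ extendMap θ φ.toLinearMap with
      invFun := extendMap θ φ.symm.toLinearMap
      left_inv := extendMap_extendMap θ _ _ φ.symm_apply_apply
      right_inv := extendMap_extendMap θ _ _ φ.apply_symm_apply },
    fun h hh => extendMap_equivariant θ α β φ.toLinearMap ⟨h, hh⟩ (hφ ⟨h, hh⟩)⟩

end Extension

/-! ### Stable isomorphisms and comparison of signs -/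

section StableIsomorphism

open Module

theorem RO.restrict_ofRep {G : Type u} [Group G] (H : Subgroup G)
    {V : Type v} [AddCommGroup V] [Module ℝ V] [FiniteDimensional ℝ V]
    (ρ : Representation ℝ G V) :
    RO.restrict H (RO.ofRep ρ) = RO.ofRep (ρ.comp H.subtype) :=
  DFunLike.congr_fun (Algebra.GrothendieckAddGroup.lift.symm_apply_apply
    (Algebra.GrothendieckAddGroup.of.comp (RealGModuleClass.restrict H))) _

variable {G : Type u} [Group G] {U V : Type v} [AddCommGroup U] [Module ℝ U]
  [FiniteDimensional ℝ U] [AddCommGroup V] [Module ℝ V] [FiniteDimensional ℝ V]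
  {ρ : Representation ℝ G U} {σ : Representation ℝ G V}

theorem exists_equiv_prod_of_ofRep_eq (h : RO.ofRep ρ = RO.ofRep σ) :
    ∃ M : RealGModule.{u, v} G, Nonempty ((M.rep.prod ρ).Equiv (M.rep.prod σ)) := by
  obtain ⟨⟨⟨M⟩, _⟩, hc⟩ := (AddLocalization.addMonoidOf ⊤).eq_iff_exists.mp h
  exact ⟨M, Quotient.exact hc⟩

/-- The summand given by the Grothendieck group carries only an `H`-action. Replacing it by a
representation of `G` lets elements of `N_G(H)` act on it too, and its own determinants later cancel
or occur squared. -/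
theorem exists_equiv_of_sub_mem_IOGroup [Finite G]
    (h : RO.ofRep ρ - RO.ofRep σ ∈ IOGroup.{u, v} G) {H : Subgroup G}
    (hH : H ∈ primePowerSubgroups G) :
    ∃ (F : Type (max u v)) (_ : AddCommGroup F) (_ : Module ℝ F) (_ : FiniteDimensional ℝ F)
      (τ : Representation ℝ G F) (φ : (F × U) ≃ₗ[ℝ] (F × V)),
      ∀ x ∈ H, ∀ a, φ (τ.prod ρ x a) = τ.prod σ x (φ a) := by
  rw [IOGroup, AddSubgroup.mem_iInf] at h
  have hker := AddSubgroup.mem_iInf.mp (h H) hH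
  rw [AddMonoidHom.mem_ker, map_sub, sub_eq_zero, RO.restrict_ofRep, RO.restrict_ofRep] at hker
  obtain ⟨M, ⟨e⟩⟩ := exists_equiv_prod_of_ofRep_eq hker
  obtain ⟨φ, hφ⟩ := exists_equiv_prod_translationRep M.rep ρ σ e.toLinearEquiv
    (fun k x => congr($(e.isIntertwining' k) x))
  exact ⟨G → M.carrier, inferInstance, inferInstance, inferInstance, translationRep G M.carrier,
    φ, hφ⟩

theorem mem_primePowerSubgroups_of_isPGroup [Finite G] {p : ℕ} (hp : p.Prime) {H : Subgroup G}
    (hH : IsPGroup p H) : H ∈ primePowerSubgroups G := by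
  have := Fact.mk hp
  obtain ⟨n, hn⟩ := IsPGroup.iff_card.mp hH
  rcases Nat.eq_zero_or_pos n with rfl | hpos
  · exact Or.inl (Subgroup.card_eq_one.mp (by simpa using hn))
  · exact Or.inr ⟨p, hp, (dvd_pow_self p hpos.ne').trans (hn ▸ H.card_subgroup_dvd_card), hH⟩

theorem exists_isPGroup_of_mem_primePowerSubgroups {P : Subgroup G}
    (hP : P ∈ primePowerSubgroups G) : ∃ p : ℕ, p.Prime ∧ IsPGroup p P := by
  rcases hP with rfl | ⟨p, hp, -, hP⟩
  -- Any prime would do for the trivial group; 2 sends it to the easier case.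
  · exact ⟨2, Nat.prime_two, IsPGroup.of_bot⟩
  · exact ⟨p, hp, hP⟩

theorem det_mul_det_pos_of_sub_mem_IOGroup [Finite G]
    (h : RO.ofRep ρ - RO.ofRep σ ∈ IOGroup.{u, v} G) {x : G}
    (hx : IsPGroup 2 (Subgroup.zpowers x)) :
    0 < LinearMap.det (ρ x) * LinearMap.det (σ x) := by
  obtain ⟨F, _, _, _, τ, φ, hφ⟩ :=
    exists_equiv_of_sub_mem_IOGroup h (mem_primePowerSubgroups_of_isPGroup Nat.prime_two hx)
  have hdet := det_rep_congr φ (hφ x (Subgroup.mem_zpowers x))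
  rw [det_prod_rep, det_prod_rep] at hdet
  rw [mul_left_cancel₀ (det_rep_ne_zero τ x) hdet]
  exact mul_self_pos.mpr (det_rep_ne_zero σ x)

theorem fixedSpaceDet_mul_pos_of_isPGroup_zpowers [Finite G]
    (h : RO.ofRep ρ - RO.ofRep σ ∈ IOGroup.{u, v} G) {P : Subgroup G}
    (hP : P ∈ primePowerSubgroups G) (g : Subgroup.normalizer (P : Set G))
    (hg : IsPGroup 2 (Subgroup.zpowers (g : G))) :
    0 < fixedSpaceDet ρ P g * fixedSpaceDet σ P g := by
  obtain ⟨p, hp, hPp⟩ := exists_isPGroup_of_mem_primePowerSubgroups hP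
  rcases hp.eq_two_or_odd' with rfl | hodd
  · have hH : IsPGroup 2 (Subgroup.zpowers (g : G) ⊔ P : Subgroup G) :=
      hg.to_sup_of_normal_right' hPp ((Subgroup.zpowers_le).mpr g.2)
    obtain ⟨F, _, _, _, τ, φ, hφ⟩ :=
      exists_equiv_of_sub_mem_IOGroup h (mem_primePowerSubgroups_of_isPGroup Nat.prime_two hH)
    have hdet := fixedSpaceDet_congr g φ (fun x hx => hφ x (Subgroup.mem_sup_right hx))
      (hφ g (Subgroup.mem_sup_left (Subgroup.mem_zpowers _)))
    rw [fixedSpaceDet_prod, fixedSpaceDet_prod] at hdet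
    rw [mul_left_cancel₀ (fixedSpaceDet_ne_zero τ P g) hdet]
    exact mul_self_pos.mpr (fixedSpaceDet_ne_zero σ P g)
  · have := Fact.mk hp
    obtain ⟨F, _, _, _, τ, φ, hφ⟩ := exists_equiv_of_sub_mem_IOGroup h hP
    have hpos := det_mul_fixedSpaceDet_pos_of_equiv g hodd hPp φ hφ
    rw [fixedSpaceDet_prod, fixedSpaceDet_prod, det_prod_rep, det_prod_rep] at hpos
    -- A second stable isomorphism, over `⟨g⟩`, unrelated to the one over `P`.
    have hdet := det_mul_det_pos_of_sub_mem_IOGroup h hg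
    set a := LinearMap.det (τ (g : G)) * fixedSpaceDet τ P g
    have hpos' : 0 < a ^ 2 * (LinearMap.det (ρ (g : G)) * LinearMap.det (σ (g : G))) *
        (fixedSpaceDet ρ P g * fixedSpaceDet σ P g) := hpos.trans_eq (by ring)
    exact pos_of_mul_pos_right hpos' (mul_nonneg (sq_nonneg a) hdet.le)

theorem fixedSpaceDet_mul_pos [Finite G]
    (h : RO.ofRep ρ - RO.ofRep σ ∈ IOGroup.{u, v} G) {P : Subgroup G}
    (hP : P ∈ primePowerSubgroups G) (g : Subgroup.normalizer (P : Set G)) :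
    0 < fixedSpaceDet ρ P g * fixedSpaceDet σ P g := by
  -- With `m` the odd part of the order, `g ^ m` has 2-power order and determinants of the same sign
  -- as `g`.
  obtain ⟨k, m, hm, hkm⟩ := Nat.exists_eq_two_pow_mul_odd (orderOf_pos (g : G)).ne'
  have hgm : IsPGroup 2 (Subgroup.zpowers ((g ^ m : Subgroup.normalizer (P : Set G)) : G)) := by
    rintro ⟨_, j, rfl⟩
    refine ⟨k, Subtype.ext ?_⟩
    change (((g : G) ^ m) ^ j) ^ 2 ^ k = 1
    rw [← zpow_natCast, zpow_comm, zpow_natCast, ← pow_mul, mul_comm m, ← hkm, pow_orderOf_eq_one,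
      one_zpow]
  have hpos := fixedSpaceDet_mul_pos_of_isPGroup_zpowers h hP (g ^ m) hgm
  rw [fixedSpaceDet_pow, fixedSpaceDet_pow, ← mul_pow] at hpos
  exact hm.pow_pos_iff.mp hpos

end StableIsomorphism

theorem mainTheorem12 {G : Type u} [Group G] [Finite G]
    {U V : Type v} [AddCommGroup U] [Module ℝ U] [FiniteDimensional ℝ U]
    [AddCommGroup V] [Module ℝ V] [FiniteDimensional ℝ V]
    (ρ : Representation ℝ G U) (σ : Representation ℝ G V)
    (h : RO.ofRep ρ - RO.ofRep σ ∈ IOGroup.{u, v} G) :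
    IsPOriented (ρ.prod σ) := by
  intro P hP
  refine ⟨(Module.finBasis ℝ (fixedSpace (ρ.prod σ) P)).orientation, fun g => ?_⟩
  rw [Orientation.map_eq_iff_det_pos _ _ (Fintype.card_fin _)]
  exact (fixedSpaceDet_mul_pos h hP g).trans_eq (fixedSpaceDet_prod ρ σ P g).symm
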